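/- Let $c>1$ be a constant. For each $n$, let $R_n$ (the red graph) and $B_n$ (the blue graph) be two independent binomial random graphs $G(n,c/n)$ on the same vertex set $[n]$. By an even alternating cycle of length $2t$ ($t\ge 1$) in $R_n\cup B_n$ we mean a cyclic sequence of vertices $v_1,\dots,v_{2t}$ such that $\{v_{2i-1},v_{2i}\}$ is an edge of $R_n$ and $\{v_{2i},v_{2i+1}\}$ is an edge of $B_n$ for every $1\le i\le t$ (with $v_{2t+1}=v_1$). The cycle need not be simple, but a repetition of a vertex is allowed only at positions of different parity: $v_1,v_3,\dots,v_{2t-1}$ are pairwise distinct, and $v_2,v_4,\dots,v_{2t}$ are pairwise distinct. Then there is a constant $\kappa>0$, depending only on $c$, such that, as $n\to\infty$, the probability that $R_n\cup B_n$ contains an even alternating cycle of length at least $\kappa\, n/\ln^8 n$ tends to $1$. -/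

import Mathlib

open Filter Topology MeasureTheory

/-- The sequence `v 0, v 1, …, v (2 * t - 1)` of vertices is an even alternating cycle of length
`2 * t` in the union of the red graph `R` and the blue graph `B`: the edge `{v 0, v 1}` is red,
`{v 1, v 2}` is blue, and so on, and the closing edge `{v (2 * t - 1), v 0}` is blue.

The cycle need not be simple: the same vertex may occur at two positions, but only at positions of
different parity. Without such a condition one could run around a short cycle many times.
Equivalently, the sequence is an ordinary (simple) directed cycle in the auxiliary bipartite digraph
with two copies `a u`, `b u` of each vertex `u`, with an arc from `a u` to `b w` for every red edge
`{u, w}` and an arc from `b u` to `a w` for every blue edge `{u, w}`. -/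
structure IsEvenAlternatingCycle {V : Type*} (R B : SimpleGraph V) (t : ℕ)
    (v : Fin (2 * t) → V) : Prop where
  pos : 0 < t
  red : ∀ (i : ℕ) (hi : i < t),
    R.Adj (v ⟨2 * i, by omega⟩) (v ⟨2 * i + 1, by omega⟩)
  blue : ∀ (i : ℕ) (hi : i < t),
    B.Adj (v ⟨2 * i + 1, by omega⟩) (v ⟨(2 * i + 2) % (2 * t), Nat.mod_lt _ (by omega)⟩)
  eq_of_parity : ∀ i j : Fin (2 * t), i.val % 2 = j.val % 2 → v i = v j → i = j

/-- The edge probability `c / n`, cut off to lie in `[0, 1]` (for `0 ≤ c` the cut-off matters only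
for the finitely many `n` with `n < c`). -/
noncomputable def edgeProb (c : ℝ) (n : ℕ) : unitInterval :=
  Set.projIcc 0 1 zero_le_one (c / n)

/-- The law of the pair (red graph, blue graph): two independent binomial random graphs
`G(n, c / n)` on the same vertex set `Fin n`. -/
noncomputable def redBlueRandom (c : ℝ) (n : ℕ) :
    Measure (SimpleGraph (Fin n) × SimpleGraph (Fin n)) :=
  (SimpleGraph.binomialRandom (Fin n) (edgeProb c n)).prod
    (SimpleGraph.binomialRandom (Fin n) (edgeProb c n))

/-!
A depth-first search in the style of Krivelevich and Sudakov finds, with probability tending to `1`,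
even an alternating cycle of linear length.

The search examines coloured edges one at a time. It keeps a stack which is an alternating path
starting with a red edge, so the vertex at height `i` looks for a red edge if `i` is even and for a
blue one if `i` is odd. Only edges from the top of the stack to vertices not met before are examined;
a present edge pushes its other end onto the stack, and a vertex all of whose edges have been
examined is popped and becomes finished. No edge is examined twice, so conditionally on the past each
examination succeeds with probability `p = c / n`.

Stop when `m = a + 6 * h` vertices have been met. Each finished vertex has had at least `n - m` edges
examined (`IsSearchState.card_done_mul_le`), so if at most `a * (n - m)` edges were examined, then at
most `a` vertices are finished and the stack has height at least `6 * h`. Otherwise `a * (n - m)`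
examinations gave at most `m` successes, which a Chernoff bound makes exponentially unlikely if `a`
is about `x * n` and `h` about `x ^ 2 * n` with `x` small, because `c > 1`.

A high stack closes up to a cycle. A blue edge from a vertex at a low even height to one at a high
odd height cannot have been examined: when the lower one was at the top of the stack it looked for
red edges, and when the upper one was, the lower one had already been met. So `h ^ 2` independent
unexamined edges are available, each of which closes a cycle of length at least `2 * h`, and all are
absent with probability `(1 - p) ^ h ^ 2`, which is exponentially small.

The two failure probabilities are bounded together in `IsSearchState.real_cylinder_inter_le`, by
induction along the search. A state of the search is only a pair of finite sets of coloured edges,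
those found present and those found absent, with a stack and a set of finished vertices satisfying
the invariants `IsSearchState`; the event "the search is in this state" is replaced by the cylinder
event that these edges are present, respectively absent.
-/

/-! ### Cylinder events for a pair of independent binomial random graphs -/

lemma measurableSet_of_finite_vertices {V : Type*} [Finite V] (S : Set (SimpleGraph V)) :
    MeasurableSet S :=
  SimpleGraph.measurableEmbedding_edgeSet.measurableSet_image.1 (Set.toFinite _).measurableSet

lemma binomialRandom_real_cylinder {V : Type*} [Fintype V] (p : unitInterval)
    {A D : Finset (Sym2 V)} (hAD : Disjoint A D) (hA : ∀ e ∈ A, ¬ e.IsDiag)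
    (hD : ∀ e ∈ D, ¬ e.IsDiag) :
    (SimpleGraph.binomialRandom V p).real
      {G | (∀ e ∈ A, e ∈ G.edgeSet) ∧ ∀ e ∈ D, e ∉ G.edgeSet} =
      (p : ℝ) ^ A.card * (1 - p : ℝ) ^ D.card := by
  classical
  have hset : (fun P : Sym2 V → Prop ↦ {i | P i}) ⁻¹' (SimpleGraph.fromEdgeSet ⁻¹'
      {G : SimpleGraph V | (∀ e ∈ A, e ∈ G.edgeSet) ∧ ∀ e ∈ D, e ∉ G.edgeSet}) =
      Set.pi ((A ∪ D : Finset (Sym2 V)) : Set (Sym2 V)) (fun e ↦ {e ∈ A}) := by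
    ext P
    simp only [Set.mem_preimage, Set.mem_ofPred_eq, SimpleGraph.edgeSet_fromEdgeSet,
      Set.mem_sdiff, Set.mem_pi, Finset.coe_union, Set.mem_union, Finset.mem_coe,
      Set.mem_singleton_iff, Sym2.mem_diagSet]
    have := Finset.disjoint_left.1 hAD
    grind
  rw [measureReal_def, SimpleGraph.binomialRandom_eq_map,
    Measure.map_apply SimpleGraph.measurable_fromEdgeSet (measurableSet_of_finite_vertices _),
    ProbabilityTheory.setBernoulli_apply', hset, Measure.infinitePi_pi _ (by simp),
    Finset.prod_union hAD, ENNReal.toReal_mul, ENNReal.toReal_prod, ENNReal.toReal_prod]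
  congr 1
  · rw [Finset.prod_congr rfl (g := fun _ ↦ (p : ℝ)), Finset.prod_const]
    intro e he
    simp [he, hA e he]
  · rw [Finset.prod_congr rfl (g := fun _ ↦ (1 - p : ℝ)), Finset.prod_const]
    intro e he
    have := Finset.disjoint_right.1 hAD he
    simp [this, hD e he]

/-- The edge `e.2` is present in the graph of colour `e.1` (`true` is red, `false` is blue). -/
def HasColouredEdge {V : Type*} (G : SimpleGraph V × SimpleGraph V) (e : Bool × Sym2 V) : Prop :=
  e.2 ∈ (bif e.1 then G.1 else G.2).edgeSet

/-- The pairs of graphs in which all coloured edges of `A` are present and all those of `D` are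
absent. -/
def colouredCylinder {V : Type*} (A D : Finset (Bool × Sym2 V)) :
    Set (SimpleGraph V × SimpleGraph V) :=
  {G | (∀ e ∈ A, HasColouredEdge G e) ∧ ∀ e ∈ D, ¬ HasColouredEdge G e}

lemma card_preimage_true_add_card_preimage_false {α : Type*} (A : Finset (Bool × α)) :
    (A.preimage (Prod.mk true) (Prod.mk_right_injective true).injOn).card +
      (A.preimage (Prod.mk false) (Prod.mk_right_injective false).injOn).card = A.card := by
  classical
  rw [← Finset.card_map (s := A.preimage (Prod.mk true) _) ⟨_, Prod.mk_right_injective true⟩,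
    ← Finset.card_map (s := A.preimage (Prod.mk false) _) ⟨_, Prod.mk_right_injective false⟩,
    ← Finset.card_union_of_disjoint]
  · congr 1
    ext ⟨b, x⟩
    cases b <;> simp
  · rw [Finset.disjoint_left]
    simp

lemma redBlue_real_colouredCylinder {V : Type*} [Fintype V] (p : unitInterval)
    {A D : Finset (Bool × Sym2 V)} (hAD : Disjoint A D) (hA : ∀ e ∈ A, ¬ e.2.IsDiag)
    (hD : ∀ e ∈ D, ¬ e.2.IsDiag) :
    ((SimpleGraph.binomialRandom V p).prod (SimpleGraph.binomialRandom V p)).real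
      (colouredCylinder A D) = (p : ℝ) ^ A.card * (1 - p : ℝ) ^ D.card := by
  classical
  let f (b : Bool) (X : Finset (Bool × Sym2 V)) : Finset (Sym2 V) :=
    X.preimage (Prod.mk b) (Prod.mk_right_injective b).injOn
  have hset : colouredCylinder A D =
      {G | (∀ e ∈ f true A, e ∈ G.edgeSet) ∧ ∀ e ∈ f true D, e ∉ G.edgeSet} ×ˢ
      {G | (∀ e ∈ f false A, e ∈ G.edgeSet) ∧ ∀ e ∈ f false D, e ∉ G.edgeSet} := by
    ext ⟨R, B⟩
    simp only [colouredCylinder, HasColouredEdge, f, Set.mem_ofPred_eq, Set.mem_prod,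
      Finset.mem_preimage, Prod.forall, Bool.forall_bool, cond_true, cond_false]
    tauto
  have hd (b : Bool) : Disjoint (f b A) (f b D) := by
    rw [Finset.disjoint_left] at hAD ⊢
    simp only [f, Finset.mem_preimage]
    exact fun e ↦ @hAD (b, e)
  have hA' (b : Bool) : ∀ e ∈ f b A, ¬ e.IsDiag := fun e he ↦ hA (b, e) (by simpa [f] using he)
  have hD' (b : Bool) : ∀ e ∈ f b D, ¬ e.IsDiag := fun e he ↦ hD (b, e) (by simpa [f] using he)
  rw [hset, measureReal_prod_prod, binomialRandom_real_cylinder p (hd _) (hA' _) (hD' _),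
    binomialRandom_real_cylinder p (hd _) (hA' _) (hD' _),
    ← card_preimage_true_add_card_preimage_false A,
    ← card_preimage_true_add_card_preimage_false D]
  simp only [f]
  ring

/-! ### The alternating depth-first search -/

/-- The vertices met so far by the search: those that are finished (recorded in `done` together with
their out-colour) and those on the stack `path 0, …, path (k - 1)`. -/
def searchVisited {V : Type*} [DecidableEq V] (done : Finset (Bool × V)) (k : ℕ) (path : ℕ → V) :
    Finset V :=
  done.image Prod.snd ∪ (Finset.range k).image path

/-- A state of the alternating depth-first search. The coloured edges examined so far are those of
`A`, which are present, and those of `D`, which are absent. A pair `(b, u)` in `done` is a finished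
vertex `u` from which edges of colour `b` were examined. The stack is `path 0, …, path (k - 1)`, from
bottom to top (values of `path` from `k` on are irrelevant); edges of colour `decide (Even i)` are
examined from `path i`, that is, red ones if `i` is even.

The field `back` says that no edge between two stack vertices has been examined in the colour of the
upper one, if the lower one has the other colour: these are the edges that can close a cycle. The
field `fresh` says that edges at unvisited vertices have been examined only from their other end. -/
structure IsSearchState {V : Type*} [DecidableEq V] (A D : Finset (Bool × Sym2 V))
    (done : Finset (Bool × V)) (k : ℕ) (path : ℕ → V) : Prop where
  disjoint : Disjoint A D
  not_isDiag : ∀ e ∈ A ∪ D, ¬ e.2.IsDiag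
  card_le : A.card ≤ done.card + k
  injOn : Set.InjOn path (Set.Iio k)
  not_done : ∀ i < k, ∀ b, (b, path i) ∉ done
  chain : ∀ i, i + 1 < k → (decide (Even i), s(path i, path (i + 1))) ∈ A
  done_mem : ∀ b u, (b, u) ∈ done → ∀ w ∉ searchVisited done k path, (b, s(u, w)) ∈ A ∪ D
  back : ∀ i j, i < j → j < k → ¬ (Even i ↔ Even j) →
    (decide (Even j), s(path i, path j)) ∉ A ∪ D
  fresh : ∀ u ∉ searchVisited done k path, ∀ b w, (b, s(u, w)) ∈ A ∪ D →
    (b, w) ∈ done ∨ ∃ i < k, path i = w ∧ b = decide (Even i)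

section
variable {V : Type*} [DecidableEq V] {A D : Finset (Bool × Sym2 V)} {done : Finset (Bool × V)}
  {k : ℕ} {path : ℕ → V}

lemma mem_searchVisited {u : V} :
    u ∈ searchVisited done k path ↔ (∃ b, (b, u) ∈ done) ∨ ∃ i < k, path i = u := by
  simp [searchVisited]

lemma card_searchVisited_le : (searchVisited done k path).card ≤ done.card + k := by
  refine (Finset.card_union_le _ _).trans (add_le_add Finset.card_image_le ?_)
  simpa using Finset.card_image_le (s := Finset.range k) (f := path)

lemma isSearchState_empty (path : ℕ → V) : IsSearchState ∅ ∅ ∅ 0 path := by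
  constructor <;> simp

namespace IsSearchState

/-- A vertex on top of the stack with no edge left to examine becomes finished. -/
lemma pop (h : IsSearchState A D done (k + 1) path)
    (hq : ∀ w ∉ searchVisited done (k + 1) path,
      (decide (Even k), s(path k, w)) ∈ A ∪ D) :
    IsSearchState A D (insert (decide (Even k), path k) done) k path := by
  have hvis (u : V) : u ∈ searchVisited (insert (decide (Even k), path k) done) k path ↔
      u ∈ searchVisited done (k + 1) path := by
    simp only [mem_searchVisited, Finset.mem_insert, Prod.mk.injEq, exists_or, exists_and_right,
      exists_eq, true_and, Nat.lt_succ_iff_lt_or_eq, or_and_right, exists_eq_left]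
    rw [eq_comm (a := u), or_comm (a := path k = u), or_assoc, or_comm (a := path k = u)]
  have hnot := h.not_done k (by omega)
  constructor
  · exact h.disjoint
  · exact h.not_isDiag
  · rw [Finset.card_insert_of_notMem (hnot _)]
    have := h.card_le
    omega
  · exact h.injOn.mono fun i hi ↦ Set.mem_Iio.2 (lt_trans hi k.lt_succ_self)
  · intro i hi b hb
    rcases Finset.mem_insert.1 hb with hb | hb
    · have := h.injOn (Set.mem_Iio.2 (by omega)) (Set.mem_Iio.2 (by omega)) (Prod.ext_iff.1 hb).2
      omega
    · exact h.not_done i (by omega) b hb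
  · exact fun i hi ↦ h.chain i (by omega)
  · intro b u hu w hw
    rw [hvis] at hw
    rcases Finset.mem_insert.1 hu with hu | hu
    · obtain ⟨rfl, rfl⟩ := Prod.ext_iff.1 hu
      exact hq w hw
    · exact h.done_mem b u hu w hw
  · exact fun i j hij hj ↦ h.back i j hij (by omega)
  · intro u hu b w hw
    rw [hvis] at hu
    rcases h.fresh u hu b w hw with h1 | ⟨i, hi, rfl, rfl⟩
    · exact .inl (Finset.mem_insert_of_mem h1)
    · rcases Nat.lt_succ_iff_lt_or_eq.1 hi with hi | rfl
      · exact .inr ⟨i, hi, rfl, rfl⟩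
      · exact .inl (Finset.mem_insert_self _ _)

/-- If the stack is empty, any unvisited vertex may start a new one. -/
lemma root (h : IsSearchState A D done 0 path) {w : V} (hw : w ∉ searchVisited done 0 path) :
    IsSearchState A D done 1 (fun _ ↦ w) := by
  have hvis (u : V) (hu : u ∉ searchVisited done 1 (fun _ ↦ w)) :
      u ∉ searchVisited done 0 path := by
    simp only [mem_searchVisited] at hu ⊢
    grind
  constructor
  · exact h.disjoint
  · exact h.not_isDiag
  · exact h.card_le.trans (by omega)
  · intro i hi j hj _
    simp only [Set.mem_Iio] at hi hj
    omega
  · intro i _ b hb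
    exact hw (mem_searchVisited.2 (.inl ⟨b, hb⟩))
  · intro i hi
    omega
  · exact fun b u hu w' hw' ↦ h.done_mem b u hu w' (hvis _ hw')
  · intro i j hij hj
    omega
  · intro u hu b w' hw'
    rcases h.fresh u (hvis u hu) b w' hw' with h1 | ⟨i, hi, _⟩
    · exact .inl h1
    · omega

/-- The edge examined from the top of the stack is found absent. -/
lemma reject (h : IsSearchState A D done (k + 1) path) {w : V}
    (hw : w ∉ searchVisited done (k + 1) path)
    (he : (decide (Even k), s(path k, w)) ∉ A ∪ D) :
    IsSearchState A (insert (decide (Even k), s(path k, w)) D) done (k + 1) path := by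
  have hstack (i : ℕ) (hi : i < k + 1) : path i ≠ w := by
    rintro rfl
    exact hw (mem_searchVisited.2 (.inr ⟨i, hi, rfl⟩))
  constructor
  · rw [Finset.disjoint_insert_right]
    exact ⟨fun h' ↦ he (Finset.mem_union_left _ h'), h.disjoint⟩
  · rw [Finset.union_insert]
    intro e he'
    rcases Finset.mem_insert.1 he' with rfl | he'
    · simpa using hstack k (by omega)
    · exact h.not_isDiag e he'
  · exact h.card_le
  · exact h.injOn
  · exact h.not_done
  · exact h.chain
  · intro b u hu w' hw'
    rw [Finset.union_insert]
    exact Finset.mem_insert_of_mem (h.done_mem b u hu w' hw')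
  · intro i j hij hj hpar
    rw [Finset.union_insert, Finset.mem_insert, not_or]
    refine ⟨fun heq ↦ ?_, h.back i j hij hj hpar⟩
    have hmem : w ∈ s(path i, path j) := by
      rw [show s(path i, path j) = s(path k, w) from (Prod.ext_iff.1 heq).2]
      exact Sym2.mem_mk_right _ _
    rcases Sym2.mem_iff.1 hmem with h1 | h1
    · exact hstack i (by omega) h1.symm
    · exact hstack j hj h1.symm
  · intro u hu b w' hw'
    rw [Finset.union_insert, Finset.mem_insert] at hw'
    rcases hw' with heq | hw'
    · obtain ⟨rfl, h2⟩ := Prod.ext_iff.1 heq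
      rcases Sym2.eq_iff.1 h2 with ⟨rfl, -⟩ | ⟨-, rfl⟩
      · exact absurd (mem_searchVisited.2 (.inr ⟨k, by omega, rfl⟩)) hu
      · exact .inr ⟨k, by omega, rfl, rfl⟩
    · exact h.fresh u hu b w' hw'

/-- The edge examined from the top of the stack is found present, and its other end is pushed. -/
lemma accept (h : IsSearchState A D done (k + 1) path) {w : V}
    (hw : w ∉ searchVisited done (k + 1) path)
    (he : (decide (Even k), s(path k, w)) ∉ A ∪ D) :
    IsSearchState (insert (decide (Even k), s(path k, w)) A) D done (k + 2)
      (Function.update path (k + 1) w) := by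
  have hstack (i : ℕ) (hi : i < k + 1) : path i ≠ w := by
    rintro rfl
    exact hw (mem_searchVisited.2 (.inr ⟨i, hi, rfl⟩))
  have hold (i : ℕ) (hi : i < k + 1) : Function.update path (k + 1) w i = path i :=
    Function.update_of_ne (by omega) _ _
  have hnew : Function.update path (k + 1) w (k + 1) = w := Function.update_self ..
  have hvis (u : V) (hu : u ∉ searchVisited done (k + 2) (Function.update path (k + 1) w)) :
      u ∉ searchVisited done (k + 1) path ∧ u ≠ w := by
    simp only [mem_searchVisited, not_or, not_exists, not_and] at hu ⊢
    refine ⟨⟨hu.1, fun i hi ↦ ?_⟩, ?_⟩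
    · rw [← hold i hi]
      exact hu.2 i (by omega)
    · rintro rfl
      exact hu.2 (k + 1) (by omega) hnew
  constructor
  · rw [Finset.disjoint_insert_left]
    exact ⟨fun h' ↦ he (Finset.mem_union_right _ h'), h.disjoint⟩
  · rw [Finset.insert_union]
    intro e he'
    rcases Finset.mem_insert.1 he' with rfl | he'
    · simpa using hstack k (by omega)
    · exact h.not_isDiag e he'
  · have := h.card_le
    have := Finset.card_insert_le (decide (Even k), s(path k, w)) A
    omega
  · intro i hi j hj hij
    simp only [Set.mem_Iio] at hi hj
    rcases Nat.lt_succ_iff_lt_or_eq.1 hi with hi | rfl <;>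
      rcases Nat.lt_succ_iff_lt_or_eq.1 hj with hj | rfl
    · rw [hold i hi, hold j hj] at hij
      exact h.injOn hi hj hij
    · rw [hold i hi, hnew] at hij
      exact absurd hij (hstack i hi)
    · rw [hold j hj, hnew] at hij
      exact absurd hij.symm (hstack j hj)
    · rfl
  · intro i hi b hb
    rcases Nat.lt_succ_iff_lt_or_eq.1 hi with hi | rfl
    · rw [hold i hi] at hb
      exact h.not_done i hi b hb
    · rw [hnew] at hb
      exact hw (mem_searchVisited.2 (.inl ⟨b, hb⟩))
  · intro i hi
    rcases Nat.lt_succ_iff_lt_or_eq.1 hi with hi | hi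
    · rw [hold i (by omega), hold (i + 1) hi]
      exact Finset.mem_insert_of_mem (h.chain i hi)
    · obtain rfl : i = k := by omega
      rw [hold i (by omega), hnew]
      exact Finset.mem_insert_self _ _
  · intro b u hu w' hw'
    rw [Finset.insert_union]
    exact Finset.mem_insert_of_mem (h.done_mem b u hu w' (hvis w' hw').1)
  · intro i j hij hj hpar
    rw [Finset.insert_union, Finset.mem_insert, not_or]
    rcases Nat.lt_succ_iff_lt_or_eq.1 hj with hj | rfl
    · rw [hold i (by omega), hold j hj]
      refine ⟨fun heq ↦ ?_, h.back i j hij hj hpar⟩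
      have hmem : w ∈ s(path i, path j) := by
        rw [show s(path i, path j) = s(path k, w) from (Prod.ext_iff.1 heq).2]
        exact Sym2.mem_mk_right _ _
      rcases Sym2.mem_iff.1 hmem with h1 | h1
      · exact hstack i (by omega) h1.symm
      · exact hstack j hj h1.symm
    · rw [hold i hij, hnew]
      constructor
      · intro heq
        have := (Prod.ext_iff.1 heq).1
        simp only [decide_eq_decide] at this
        rw [Nat.even_add_one] at this
        tauto
      · intro hmem
        rw [Sym2.eq_swap] at hmem
        rcases h.fresh w hw _ _ hmem with h1 | ⟨i', hi', h1, h2⟩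
        · exact h.not_done i hij _ h1
        · obtain rfl := h.injOn hi' hij h1
          simp only [decide_eq_decide] at h2
          exact hpar h2.symm
  · intro u hu b w' hw'
    obtain ⟨hu1, hu2⟩ := hvis u hu
    rw [Finset.insert_union, Finset.mem_insert] at hw'
    rcases hw' with heq | hw'
    · obtain ⟨rfl, h2⟩ := Prod.ext_iff.1 heq
      rcases Sym2.eq_iff.1 h2 with ⟨rfl, -⟩ | ⟨rfl, -⟩
      · exact absurd (mem_searchVisited.2 (.inr ⟨k, by omega, rfl⟩)) hu1
      · exact absurd rfl hu2
    · rcases h.fresh u hu1 b w' hw' with h1 | ⟨i, hi, rfl, rfl⟩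
      · exact .inl h1
      · exact .inr ⟨i, by omega, hold i hi, rfl⟩

/-- Every finished vertex has had all its edges to unvisited vertices examined, in one colour, and
these edges are distinct for distinct finished vertices. -/
lemma card_done_mul_le [Fintype V] (h : IsSearchState A D done k path) :
    done.card * (Fintype.card V - (done.card + k)) ≤ A.card + D.card := by
  have hle : Fintype.card V - (done.card + k) ≤ (searchVisited done k path)ᶜ.card := by
    rw [Finset.card_compl]
    exact Nat.sub_le_sub_left card_searchVisited_le _
  refine (Nat.mul_le_mul_left _ hle).trans ?_
  rw [← Finset.card_product, ← Finset.card_union_of_disjoint h.disjoint]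
  refine Finset.card_le_card_of_injOn (fun x ↦ (x.1.1, s(x.1.2, x.2))) ?_ ?_
  · rintro ⟨⟨b, u⟩, w⟩ hx
    simp only [Finset.coe_product, Set.mem_prod, Finset.mem_coe, Finset.mem_compl] at hx
    exact h.done_mem b u hx.1 w hx.2
  · rintro ⟨⟨b, u⟩, w⟩ hx ⟨⟨b', u'⟩, w'⟩ hx' heq
    simp only [Finset.coe_product, Set.mem_prod, Finset.mem_coe, Finset.mem_compl] at hx hx'
    obtain ⟨rfl, h2⟩ := Prod.ext_iff.1 heq
    rcases Sym2.eq_iff.1 h2 with ⟨h3, h4⟩ | ⟨h3, h4⟩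
    · simp only at h3 h4
      rw [h3, h4]
    · simp only at h3 h4
      subst h3
      exact absurd (mem_searchVisited.2 (.inl ⟨_, hx.1⟩)) hx'.2

end IsSearchState
end

/-! ### Closing the stack to a cycle, and the failure probability -/

/-- The pairs (red graph, blue graph) without an even alternating cycle of length at least `ℓ`. -/
def noLongAlternatingCycle (V : Type*) (ℓ : ℕ) : Set (SimpleGraph V × SimpleGraph V) :=
  {G | ¬ ∃ (t : ℕ) (v : Fin (2 * t) → V), IsEvenAlternatingCycle G.1 G.2 t v ∧ ℓ ≤ 2 * t}

/-- A blue edge from an even position of an alternating path to a later odd one closes an even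
alternating cycle, which is in fact simple. -/
lemma isEvenAlternatingCycle_of_path {V : Type*} {R B : SimpleGraph V} {k i t : ℕ} {path : ℕ → V}
    (hinj : Set.InjOn path (Set.Iio k))
    (hred : ∀ j, j + 1 < k → Even j → R.Adj (path j) (path (j + 1)))
    (hblue : ∀ j, j + 1 < k → ¬ Even j → B.Adj (path j) (path (j + 1)))
    (hi : Even i) (ht : 0 < t) (hit : i + 2 * t ≤ k)
    (hclose : B.Adj (path i) (path (i + 2 * t - 1))) :
    IsEvenAlternatingCycle R B t (fun r ↦ path (i + r)) := by
  refine ⟨ht, ?_, ?_, ?_⟩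
  · intro j hj
    exact hred (i + 2 * j) (by omega) (by simp [hi, Nat.even_add])
  · intro j hj
    rcases Nat.lt_or_ge (j + 1) t with hjt | hjt
    · have hmod : (2 * j + 2) % (2 * t) = 2 * j + 2 := Nat.mod_eq_of_lt (by omega)
      simp only [hmod]
      exact hblue (i + (2 * j + 1)) (by omega) (by simp [hi, Nat.even_add])
    · obtain rfl : t = j + 1 := by omega
      have hmod : (2 * j + 2) % (2 * (j + 1)) = 0 := by rw [mul_add, mul_one, Nat.mod_self]
      simp only [hmod, add_zero]
      exact hclose.symm
  · intro a b _ hab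
    have := hinj (Set.mem_Iio.2 (by omega)) (Set.mem_Iio.2 (by omega)) hab
    exact Fin.ext (by omega)

section
variable {V : Type*} [DecidableEq V] {A D : Finset (Bool × Sym2 V)} {done : Finset (Bool × V)}
  {k : ℕ} {path : ℕ → V}

/-- Blue edges from even positions below `2 * h` to odd positions between `4 * h` and `6 * h` of a
stack. Each of them closes an even alternating cycle of length at least `2 * h`. -/
def closingEdges (path : ℕ → V) (h : ℕ) : Finset (Bool × Sym2 V) :=
  (Finset.range h ×ˢ Finset.range h).image
    fun x ↦ (false, s(path (2 * x.1), path (4 * h + 2 * x.2 + 1)))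

namespace IsSearchState

lemma card_closingEdges {h : ℕ} (hs : IsSearchState A D done k path) (hk : 6 * h ≤ k) :
    (closingEdges path h).card = h ^ 2 := by
  rw [closingEdges, Finset.card_image_of_injOn, Finset.card_product, Finset.card_range, sq]
  rintro ⟨i, j⟩ hx ⟨i', j'⟩ hx' heq
  simp only [Finset.coe_product, Finset.coe_range, Set.mem_prod, Set.mem_Iio] at hx hx'
  have inj {a b : ℕ} (ha : a < k) (hb : b < k) (hab : path a = path b) : a = b :=
    hs.injOn ha hb hab
  rcases Sym2.eq_iff.1 (Prod.ext_iff.1 heq).2 with ⟨h1, h2⟩ | ⟨h1, h2⟩ <;>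
    have h1 := inj (by omega) (by omega) h1 <;> have h2 := inj (by omega) (by omega) h2
  · exact Prod.ext (by simp only at h1 ⊢; omega) (by simp only at h2 ⊢; omega)
  · simp only at h1
    omega

lemma not_isDiag_of_mem_closingEdges {h : ℕ} (hs : IsSearchState A D done k path) (hk : 6 * h ≤ k) :
    ∀ e ∈ closingEdges path h, ¬ e.2.IsDiag := by
  intro e he
  simp only [closingEdges, Finset.mem_image, Finset.mem_product, Finset.mem_range] at he
  obtain ⟨⟨i, j⟩, hx, rfl⟩ := he
  simp only [Sym2.mk_isDiag_iff]
  intro heq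
  have := hs.injOn (Set.mem_Iio.2 (by omega)) (Set.mem_Iio.2 (by omega)) heq
  omega

lemma disjoint_closingEdges {h : ℕ} (hs : IsSearchState A D done k path) (hk : 6 * h ≤ k) :
    Disjoint (closingEdges path h) (A ∪ D) := by
  rw [Finset.disjoint_left]
  intro e he
  simp only [closingEdges, Finset.mem_image, Finset.mem_product, Finset.mem_range] at he
  obtain ⟨⟨i, j⟩, hx, rfl⟩ := he
  have hodd : ¬ Even (4 * h + 2 * j + 1) := by simp [Nat.even_add_one, Nat.even_add]
  have := hs.back (2 * i) (4 * h + 2 * j + 1) (by omega) (by omega) (by simp [hodd])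
  simpa [hodd] using this

lemma cylinder_inter_noLongAlternatingCycle_subset {h : ℕ} (hs : IsSearchState A D done k path)
    (hk : 6 * h ≤ k) :
    colouredCylinder A D ∩ noLongAlternatingCycle V (2 * h) ⊆
      colouredCylinder A (D ∪ closingEdges path h) := by
  rintro ⟨R, B⟩ ⟨⟨hA, hD⟩, hno⟩
  refine ⟨hA, fun e he ↦ ?_⟩
  rcases Finset.mem_union.1 he with he | he
  · exact hD e he
  simp only [closingEdges, Finset.mem_image, Finset.mem_product, Finset.mem_range] at he
  obtain ⟨⟨i, j⟩, hx, rfl⟩ := he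
  intro hclose
  refine hno ⟨2 * h + j + 1 - i, _, isEvenAlternatingCycle_of_path (R := R) (B := B) (i := 2 * i)
    hs.injOn ?_ ?_ (by simp) (by omega) (by omega) ?_, by omega⟩
  · intro j hj hev
    simpa [HasColouredEdge, hev] using hA _ (hs.chain j hj)
  · intro j hj hev
    simpa [HasColouredEdge, hev] using hA _ (hs.chain j hj)
  · rw [show 2 * i + 2 * (2 * h + j + 1 - i) - 1 = 4 * h + 2 * j + 1 by omega]
    simpa [HasColouredEdge] using hclose

/-- The failure probability along the search. With `q = 1 - p`, the factor `p ^ #A * q ^ #D` is the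
probability of the cylinder. Given the cylinder, if `N` examinations are left, there is no long cycle
with probability at most `τ ^ (m - #A) * (q + p / τ) ^ N + q ^ h ^ 2`. The first term bounds the
probability that the successes stay at most `m` in number: by Markov's inequality it is at most the
expectation of `τ ^ (m - #A - X)` with `X` binomial with parameters `N` and `p`. The second bounds
the probability that no closing edge of a high stack is present.

The induction is on `f`, which every step of the search decreases. -/
lemma real_cylinder_inter_le [Fintype V] (p : unitInterval) {τ : ℝ} (hτ : 1 ≤ τ) {a h m : ℕ}
    (hm : m = a + 6 * h) (hmV : m < Fintype.card V) (f : ℕ) :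
    ∀ {A D : Finset (Bool × Sym2 V)} {done : Finset (Bool × V)} {k : ℕ} {path : ℕ → V} {N : ℕ},
      IsSearchState A D done k path → done.card + k ≤ m →
      A.card + D.card + N = a * (Fintype.card V - m) →
      N + 2 * (m - (done.card + k)) + k = f →
      ((SimpleGraph.binomialRandom V p).prod (SimpleGraph.binomialRandom V p)).real
        (colouredCylinder A D ∩ noLongAlternatingCycle V (2 * h)) ≤
      (p : ℝ) ^ A.card * (1 - p : ℝ) ^ D.card *
        (τ ^ (m - A.card) * ((1 - p) + p / τ) ^ N + (1 - p : ℝ) ^ (h ^ 2)) := by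
  have hp : (0 : ℝ) ≤ p := p.2.1
  have hq : (0 : ℝ) ≤ 1 - p := sub_nonneg.2 p.2.2
  have hτ0 : (0 : ℝ) < τ := by linarith
  set μ := (SimpleGraph.binomialRandom V p).prod (SimpleGraph.binomialRandom V p)
  induction f using Nat.strong_induction_on with
  | _ f ih =>
  intro A D done k path N hs hle hN hf
  have hDiagA : ∀ e ∈ A, ¬ e.2.IsDiag := fun e he ↦ hs.not_isDiag e (Finset.mem_union_left _ he)
  have hDiagD : ∀ e ∈ D, ¬ e.2.IsDiag := fun e he ↦ hs.not_isDiag e (Finset.mem_union_right _ he)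
  rcases hle.eq_or_lt with heq | hlt
  · -- `m` vertices have been met; few of them are finished, so the stack is high.
    have hdone : done.card ≤ a := by
      have h1 := hs.card_done_mul_le
      rw [heq] at h1
      exact Nat.le_of_mul_le_mul_right (h1.trans (by omega)) (Nat.sub_pos_of_lt hmV)
    have hk : 6 * h ≤ k := by omega
    have hdisj := hs.disjoint_closingEdges hk
    rw [Finset.disjoint_union_right] at hdisj
    calc μ.real (colouredCylinder A D ∩ noLongAlternatingCycle V (2 * h))
        ≤ μ.real (colouredCylinder A (D ∪ closingEdges path h)) :=
          measureReal_mono (hs.cylinder_inter_noLongAlternatingCycle_subset hk)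
      _ = (p : ℝ) ^ A.card * (1 - p : ℝ) ^ D.card * (1 - p : ℝ) ^ (h ^ 2) := by
          rw [redBlue_real_colouredCylinder p
            (Finset.disjoint_union_right.2 ⟨hs.disjoint, hdisj.1.symm⟩) hDiagA ?_,
            Finset.card_union_of_disjoint hdisj.2.symm, hs.card_closingEdges hk, pow_add, mul_assoc]
          intro e he
          rcases Finset.mem_union.1 he with he | he
          · exact hDiagD e he
          · exact hs.not_isDiag_of_mem_closingEdges hk e he
      _ ≤ _ := by
          refine mul_le_mul_of_nonneg_left ?_ (by positivity)
          exact le_add_of_nonneg_left (by positivity)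
  rcases Nat.eq_zero_or_pos N with rfl | hNpos
  · -- No examination is left, and `τ ^ (m - #A) ≥ 1` makes the bound trivial.
    calc μ.real (colouredCylinder A D ∩ noLongAlternatingCycle V (2 * h))
        ≤ μ.real (colouredCylinder A D) := measureReal_mono Set.inter_subset_left
      _ = (p : ℝ) ^ A.card * (1 - p : ℝ) ^ D.card * 1 := by
          rw [redBlue_real_colouredCylinder p hs.disjoint hDiagA hDiagD, mul_one]
      _ ≤ _ := by
          refine mul_le_mul_of_nonneg_left ?_ (by positivity)
          rw [pow_zero, mul_one]
          exact le_add_of_le_of_nonneg (one_le_pow₀ hτ) (by positivity)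
  obtain _ | k := k
  · -- The stack is empty: start again from an unvisited vertex.
    obtain ⟨w, hw⟩ : ∃ w, w ∉ searchVisited done 0 path := by
      by_contra! hall
      have h1 := card_searchVisited_le (done := done) (k := 0) (path := path)
      rw [Finset.eq_univ_iff_forall.2 hall, Finset.card_univ] at h1
      omega
    exact ih _ (by omega) (hs.root hw) (by omega) hN rfl
  by_cases hex : ∃ w ∉ searchVisited done (k + 1) path, (decide (Even k), s(path k, w)) ∉ A ∪ D
  · -- Examine a new edge `e` at the top of the stack.
    obtain ⟨w, hw, he⟩ := hex
    obtain ⟨N, rfl⟩ := Nat.exists_eq_add_of_lt hNpos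
    simp only [zero_add] at hN hf ⊢
    set e := (decide (Even k), s(path k, w)) with he_def
    obtain ⟨heA, heD⟩ := not_or.1 (Finset.mem_union.not.1 he)
    have hAm : A.card + 1 ≤ m := by
      have := hs.card_le
      omega
    have hacc := ih _ (by omega) (hs.accept hw he) (by omega) (N := N)
      (by rw [Finset.card_insert_of_notMem heA]; omega) rfl
    have hrej := ih _ (by omega) (hs.reject hw he) (by omega) (N := N)
      (by rw [Finset.card_insert_of_notMem heD]; omega) rfl
    rw [← he_def, Finset.card_insert_of_notMem heA] at hacc
    rw [← he_def, Finset.card_insert_of_notMem heD] at hrej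
    have hsub : colouredCylinder A D ∩ noLongAlternatingCycle V (2 * h) ⊆
        (colouredCylinder (insert e A) D ∩ noLongAlternatingCycle V (2 * h)) ∪
        (colouredCylinder A (insert e D) ∩ noLongAlternatingCycle V (2 * h)) := by
      rintro G ⟨⟨h1, h2⟩, hno⟩
      by_cases hG : HasColouredEdge G e
      · exact .inl ⟨⟨Finset.forall_mem_insert .. |>.2 ⟨hG, h1⟩, h2⟩, hno⟩
      · exact .inr ⟨⟨h1, Finset.forall_mem_insert .. |>.2 ⟨hG, h2⟩⟩, hno⟩
    refine (measureReal_mono hsub).trans ((measureReal_union_le _ _).trans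
      ((add_le_add hacc hrej).trans (le_of_eq ?_)))
    obtain ⟨r, rfl⟩ : ∃ r, m = A.card + 1 + r := Nat.exists_eq_add_of_le hAm
    rw [Nat.add_sub_cancel_left, show A.card + 1 + r - A.card = r + 1 by omega]
    have hσ : (p : ℝ) / τ * τ = p := div_mul_cancel₀ _ hτ0.ne'
    generalize (p : ℝ) / τ = σ at hσ ⊢
    linear_combination
      (-(p : ℝ) ^ A.card * (1 - p : ℝ) ^ D.card * τ ^ r * ((1 - p) + σ) ^ N) * hσ
  · -- All edges to unvisited vertices have been examined: the top of the stack is finished.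
    push Not at hex
    have hcard : (insert (decide (Even k), path k) done).card = done.card + 1 :=
      Finset.card_insert_of_notMem (hs.not_done k (by omega) _)
    exact ih _ (by omega) (hs.pop hex) (by omega) hN rfl

end IsSearchState

/-- The failure probability of the whole search, which stops when `a + 6 * h` vertices have been met
or `a * (#V - (a + 6 * h))` edges have been examined. -/
lemma real_noLongAlternatingCycle_le [Fintype V] (p : unitInterval) {τ : ℝ} (hτ : 1 ≤ τ)
    {a h : ℕ} (hV : a + 6 * h < Fintype.card V) :
    ((SimpleGraph.binomialRandom V p).prod (SimpleGraph.binomialRandom V p)).real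
        (noLongAlternatingCycle V (2 * h)) ≤
      τ ^ (a + 6 * h) * ((1 - p) + p / τ) ^ (a * (Fintype.card V - (a + 6 * h))) +
        (1 - p : ℝ) ^ (h ^ 2) := by
  obtain ⟨v⟩ : Nonempty V := Fintype.card_pos_iff.1 (by omega)
  have := IsSearchState.real_cylinder_inter_le p hτ rfl hV _ (isSearchState_empty fun _ ↦ v)
    (N := a * (Fintype.card V - (a + 6 * h))) (by simp) (by simp) rfl
  simpa [colouredCylinder] using this

end

/-! ### Asymptotics -/

/-- The choice of `x`: if about `x * n` vertices may be finished and the stack has height about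
`6 * x ^ 2 * n`, then `a * (n - m) * p` exceeds `m` by a factor of more than `1 + x`. -/
lemma exists_pos_mul_lt_of_one_lt {c : ℝ} (hc : 1 < c) :
    ∃ x : ℝ, 0 < x ∧ 0 < 1 - x - 6 * x ^ 2 ∧ (1 + 6 * x) * (1 + x) < c * (1 - x - 6 * x ^ 2) := by
  have h1 : ∀ᶠ x : ℝ in 𝓝 0, 0 < 1 - x - 6 * x ^ 2 :=
    ContinuousAt.eventually_lt (by fun_prop) (by fun_prop) (by norm_num)
  have h2 : ∀ᶠ x : ℝ in 𝓝 0, (1 + 6 * x) * (1 + x) < c * (1 - x - 6 * x ^ 2) :=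
    ContinuousAt.eventually_lt (by fun_prop) (by fun_prop) (by norm_num [hc])
  have h3 : ∀ᶠ x : ℝ in 𝓝[>] 0, 0 < x := eventually_mem_nhdsWithin
  obtain ⟨x, h1, h2, h3⟩ :=
    ((h1.filter_mono nhdsWithin_le_nhds).and ((h2.filter_mono nhdsWithin_le_nhds).and h3)).exists
  exact ⟨x, h3, h1, h2⟩

/-- The Chernoff term of the failure probability, with `τ = 1 + x`. -/
lemma pow_mul_pow_le_exp {c x n p : ℝ} (hx : 0 < x) (hn : 0 < n) (hp : 0 ≤ p) (hp1 : p ≤ 1)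
    (hpn : p * n = c) (hx1 : 0 ≤ 1 - x - 6 * x ^ 2) {a h b : ℕ} (ha : (a : ℝ) ≤ x * n)
    (ha' : x * n - 1 ≤ a) (hh : (h : ℝ) ≤ x ^ 2 * n) (hb : n - (a + 6 * h) ≤ b) :
    (1 + x) ^ (a + 6 * h) * ((1 - p) + p / (1 + x)) ^ (a * b) ≤
      Real.exp (x * c * (1 - x - 6 * x ^ 2) / (1 + x) -
        x ^ 2 * (c * (1 - x - 6 * x ^ 2) / (1 + x) - (1 + 6 * x)) * n) := by
  have hx' : 0 < 1 + x := by linarith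
  have hρ : (1 - p) + p / (1 + x) = 1 - p * x / (1 + x) := by
    field_simp
    ring
  have hρ0 : 0 ≤ (1 - p) + p / (1 + x) := by
    have := div_nonneg hp hx'.le
    linarith
  calc (1 + x) ^ (a + 6 * h) * ((1 - p) + p / (1 + x)) ^ (a * b)
      ≤ Real.exp x ^ (a + 6 * h) * Real.exp (-(p * x / (1 + x))) ^ (a * b) := by
        gcongr
        · linarith [Real.add_one_le_exp x]
        · rw [hρ]
          linarith [Real.add_one_le_exp (-(p * x / (1 + x)))]
    _ = Real.exp (x * (a + 6 * h) - x / (1 + x) * (p * (a * b))) := by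
        rw [← Real.exp_nat_mul, ← Real.exp_nat_mul, ← Real.exp_add]
        congr 1
        push_cast
        ring
    _ ≤ _ := by
        rw [Real.exp_le_exp]
        have h1 : x * (a + 6 * h) ≤ x * (x * n + 6 * (x ^ 2 * n)) := by gcongr
        have h2 : n * (1 - x - 6 * x ^ 2) ≤ b := by linarith
        have h3 : (x * n - 1) * (n * (1 - x - 6 * x ^ 2)) ≤ a * b :=
          (mul_le_mul_of_nonneg_right ha' (by positivity)).trans
            (mul_le_mul_of_nonneg_left h2 (by positivity))
        have h4 : x / (1 + x) * (p * ((x * n - 1) * (n * (1 - x - 6 * x ^ 2)))) ≤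
          x / (1 + x) * (p * (a * b)) := by gcongr
        have h5 : x / (1 + x) * (p * ((x * n - 1) * (n * (1 - x - 6 * x ^ 2)))) =
            x / (1 + x) * (c * (x * n - 1) * (1 - x - 6 * x ^ 2)) := by
          rw [← hpn]
          ring
        rw [h5] at h4
        refine (sub_le_sub h1 h4).trans (le_of_eq ?_)
        field_simp
        ring

lemma one_sub_pow_le_exp {c x n p : ℝ} (hn : 0 < n) (hp : 0 ≤ p) (hp1 : p ≤ 1)
    (hpn : p * n = c) {h : ℕ} (hh : x ^ 2 / 2 * n ≤ h) :
    (1 - p) ^ (h ^ 2) ≤ Real.exp (-(c * x ^ 4 / 4) * n) := by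
  calc (1 - p) ^ (h ^ 2) ≤ Real.exp (-p) ^ (h ^ 2) :=
        pow_le_pow_left₀ (by linarith) (by linarith [Real.add_one_le_exp (-p)]) _
    _ = Real.exp (-(p * h ^ 2)) := by
        rw [← Real.exp_nat_mul]
        congr 1
        push_cast
        ring
    _ ≤ _ := by
        rw [Real.exp_le_exp]
        have h1 : p * (x ^ 2 / 2 * n) ^ 2 ≤ p * h ^ 2 := by gcongr
        rw [← hpn]
        linarith

lemma tendsto_exp_sub_mul_natCast (C : ℝ) {K : ℝ} (hK : 0 < K) :
    Tendsto (fun n : ℕ ↦ Real.exp (C - K * n)) atTop (𝓝 0) := by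
  refine Real.tendsto_exp_atBot.comp ?_
  simp only [sub_eq_add_neg]
  refine tendsto_atBot_add_const_left _ _ (tendsto_neg_atTop_atBot.comp ?_)
  exact tendsto_natCast_atTop_atTop.const_mul_atTop hK

/-- The red and blue graphs contain an even alternating cycle of linear length with probability
tending to `1`. -/
theorem tendsto_redBlueRandom_linear_cycle {c : ℝ} (hc : 1 < c) :
    ∃ κ : ℝ, 0 < κ ∧ Tendsto (fun n : ℕ ↦ redBlueRandom c n
      {G | ∃ (t : ℕ) (v : Fin (2 * t) → Fin n),
        IsEvenAlternatingCycle G.1 G.2 t v ∧ κ * n ≤ ((2 * t : ℕ) : ℝ)}) atTop (𝓝 1) := by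
  obtain ⟨x, hx, hx1, hx2⟩ := exists_pos_mul_lt_of_one_lt hc
  have hx' : 0 < 1 + x := by linarith
  set C := x * c * (1 - x - 6 * x ^ 2) / (1 + x)
  set K := x ^ 2 * (c * (1 - x - 6 * x ^ 2) / (1 + x) - (1 + 6 * x))
  have hK : 0 < K := by
    refine mul_pos (by positivity) (sub_pos.2 ?_)
    rwa [lt_div_iff₀ hx']
  have hK' : 0 < c * x ^ 4 / 4 := by positivity
  refine ⟨x ^ 2, by positivity, ?_⟩
  have hlim : Tendsto (fun n : ℕ ↦ ENNReal.ofReal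
      (1 - (Real.exp (C - K * n) + Real.exp (0 - c * x ^ 4 / 4 * n)))) atTop (𝓝 1) := by
    have := ((tendsto_exp_sub_mul_natCast C hK).add (tendsto_exp_sub_mul_natCast 0 hK')).const_sub 1
    simpa using ENNReal.tendsto_ofReal this
  refine tendsto_of_tendsto_of_tendsto_of_le_of_le' hlim tendsto_const_nhds ?_
    (.of_forall fun n ↦ by rw [redBlueRandom]; exact prob_le_one)
  filter_upwards [tendsto_natCast_atTop_atTop.eventually_ge_atTop c,
    tendsto_natCast_atTop_atTop.eventually_ge_atTop (2 / x ^ 2)] with n hnc hnx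
  have hn : (0 : ℝ) < n := by linarith
  have hp : (edgeProb c n : ℝ) = c / n := by
    have hmem : c / n ∈ Set.Icc (0 : ℝ) 1 := ⟨by positivity, div_le_one_of_le₀ hnc hn.le⟩
    rw [edgeProb, Set.projIcc_of_mem _ hmem]
  have hpn : (edgeProb c n : ℝ) * n = c := by rw [hp, div_mul_cancel₀ _ hn.ne']
  have hp0 : (0 : ℝ) ≤ edgeProb c n := (edgeProb c n).2.1
  have hp1 : (edgeProb c n : ℝ) ≤ 1 := (edgeProb c n).2.2
  set a := ⌊x * n⌋₊
  set h := ⌊x ^ 2 * n⌋₊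
  have ha : (a : ℝ) ≤ x * n := Nat.floor_le (by positivity)
  have ha' : x * n - 1 ≤ a := (Nat.sub_one_lt_floor _).le
  have hh : (h : ℝ) ≤ x ^ 2 * n := Nat.floor_le (by positivity)
  have hh' : x ^ 2 / 2 * n ≤ h := by
    have h1 := (Nat.sub_one_lt_floor (x ^ 2 * n)).le
    rw [div_le_iff₀ (by positivity)] at hnx
    linarith
  have hm : a + 6 * h < n := by
    have : (0 : ℝ) < n * (1 - x - 6 * x ^ 2) := mul_pos hn hx1
    have : ((a + 6 * h : ℕ) : ℝ) < n := by
      push_cast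
      linarith
    exact_mod_cast this
  have hbad := real_noLongAlternatingCycle_le (V := Fin n) (edgeProb c n)
    (τ := 1 + x) (by linarith) (a := a) (h := h) (by simpa using hm)
  rw [Fintype.card_fin] at hbad
  have hE1 := pow_mul_pow_le_exp hx hn hp0 hp1 hpn hx1.le ha ha' hh
    (b := n - (a + 6 * h)) (by rw [Nat.cast_sub hm.le]; push_cast; rfl)
  have hE2 := one_sub_pow_le_exp hn hp0 hp1 hpn hh'
  set S := {G : SimpleGraph (Fin n) × SimpleGraph (Fin n) | ∃ (t : ℕ) (v : Fin (2 * t) → Fin n),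
        IsEvenAlternatingCycle G.1 G.2 t v ∧ x ^ 2 * n ≤ ((2 * t : ℕ) : ℝ)}
  have hcover : Set.univ ⊆ S ∪ noLongAlternatingCycle (Fin n) (2 * h) := by
    intro G _
    by_cases hG : G ∈ noLongAlternatingCycle (Fin n) (2 * h)
    · exact .inr hG
    · obtain ⟨t, v, hv, ht⟩ := not_not.1 hG
      refine .inl ⟨t, v, hv, ?_⟩
      have : ((2 * h : ℕ) : ℝ) ≤ ((2 * t : ℕ) : ℝ) := by exact_mod_cast ht
      refine le_trans ?_ this
      push_cast
      linarith
  rw [redBlueRandom]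
  set μ := (SimpleGraph.binomialRandom (Fin n) (edgeProb c n)).prod
    (SimpleGraph.binomialRandom (Fin n) (edgeProb c n))
  have hone : (1 : ℝ) ≤ μ.real S + μ.real (noLongAlternatingCycle (Fin n) (2 * h)) := by
    refine le_trans (le_of_eq ?_) ((measureReal_mono hcover).trans (measureReal_union_le _ _))
    simp
  rw [ENNReal.ofReal_le_iff_le_toReal (measure_ne_top _ _), ← measureReal_def]
  rw [neg_mul, ← zero_sub] at hE2
  linarith

theorem mainTheorem7 (c : ℝ) (hc : 1 < c) :
    ∃ κ : ℝ, 0 < κ ∧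
      Tendsto
        (fun n : ℕ => redBlueRandom c n
          {G | ∃ (t : ℕ) (v : Fin (2 * t) → Fin n),
            IsEvenAlternatingCycle G.1 G.2 t v ∧
              κ * ((n : ℝ) / Real.log (n : ℝ) ^ 8) ≤ ((2 * t : ℕ) : ℝ)})
        atTop (𝓝 1) := by
  obtain ⟨κ, hκ, hlim⟩ := tendsto_redBlueRandom_linear_cycle hc
  refine ⟨κ, hκ, tendsto_of_tendsto_of_tendsto_of_le_of_le' hlim tendsto_const_nhds ?_
    (.of_forall fun n ↦ by rw [redBlueRandom]; exact prob_le_one)⟩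
  filter_upwards [(Real.tendsto_log_atTop.comp tendsto_natCast_atTop_atTop).eventually_ge_atTop 1]
    with n hn
  refine measure_mono ?_
  rintro G ⟨t, v, hv, ht⟩
  refine ⟨t, v, hv, le_trans ?_ ht⟩
  gcongr
  exact div_le_self (Nat.cast_nonneg n) (one_le_pow₀ hn)
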